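/- Let $p,n\ge 0$ be integers, $\theta\in\mathbb R^p$ and $\sigma>0$. Let $x\sim\mathcal N(0,I_p)$ and $y=\langle x,\theta\rangle+\varepsilon$ with $\varepsilon\sim\mathcal N(0,\sigma^2)$ independent of $x$, and let $(x_1,y_1),\dots,(x_n,y_n)$ be independent copies of $(x,y)$; let $X\in\mathbb R^{n\times p}$ be the matrix with rows $x_i^\top$ and $\vec y=(y_1,\dots,y_n)^\top$. For an integer $0\le d\le p$ let $P\in\mathbb R^{d\times p}$ be a uniformly (Haar) distributed random matrix with orthonormal rows, independent of the sample, and put $\tilde X=XP^\top$. For $\lambda\ge 0$ let $$\hat\beta_{d,\lambda}=\hat\beta_{d,\lambda}(\tilde X,\vec y):=\operatorname*{argmin}_{\beta\in\mathbb R^d}\ \|\tilde X\beta-\vec y\|_2^2+\lambda\|\beta\|_2^2,$$ where for $\lambda=0$ the minimizer of least Euclidean norm is taken. For $\beta\in\mathbb R^d$ let $R_P(\beta):=\mathbb E_{(x,y)}\big[(\langle Px,\beta\rangle-y)^2\big]$, and define the expected test risk $$\bar R(\hat\beta_{d,\lambda}):=\mathbb E_P\,\mathbb E_{X,\vec y}\big[R_P(\hat\beta_{d,\lambda}(\tilde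 X,\vec y))\big]\in[0,\infty].$$ Let $\bar R(\hat\beta^{\rm opt}_d):=\inf_{\lambda\ge 0}\bar R(\hat\beta_{d,\lambda})$ be the expected test risk under optimally tuned $\ell_2$ regularization. Then for every $d\le p$ this quantity is finite, and if $\theta\neq 0$ the infimum is attained at some $\lambda_d^{\rm opt}\ge 0$. Moreover, for every $d$ with $d+1\le p$, $$\bar R(\hat\beta^{\rm opt}_{d+1})\ \le\ \bar R(\hat\beta^{\rm opt}_{d}).$$ -/

import Mathlib

open MeasureTheory ProbabilityTheory
open scoped NNReal ENNReal Matrix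

namespace ProjRidge

/-! ### The uniformly random orthonormal matrix -/

/-- The Borel sigma-algebra of the orthogonal group. -/
instance instMeasurableSpaceOrthogonal (p : ℕ) :
    MeasurableSpace (Matrix.orthogonalGroup (Fin p) ℝ) := borel _

instance instBorelSpaceOrthogonal (p : ℕ) :
    BorelSpace (Matrix.orthogonalGroup (Fin p) ℝ) := ⟨rfl⟩

instance instCompactSpaceOrthogonal (p : ℕ) :
    CompactSpace (Matrix.orthogonalGroup (Fin p) ℝ) := by
  refine isCompact_iff_compactSpace.mp ?_
  have hK : IsCompact (Set.pi Set.univ fun _ : Fin p =>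
      Set.pi Set.univ fun _ : Fin p => Set.Icc (-1 : ℝ) 1) :=
    isCompact_univ_pi fun _ => isCompact_univ_pi fun _ => isCompact_Icc
  refine IsCompact.of_isClosed_subset (X := Matrix (Fin p) (Fin p) ℝ) hK ?_ ?_
  · have h : ((Matrix.orthogonalGroup (Fin p) ℝ : Submonoid (Matrix (Fin p) (Fin p) ℝ)) :
        Set (Matrix (Fin p) (Fin p) ℝ)) = {A | A * star A = 1} := by
      ext A
      exact Matrix.mem_orthogonalGroup_iff (Fin p) ℝ
    rw [h]
    exact isClosed_eq (continuous_id.mul continuous_star) continuous_const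
  · intro A hA i _ j _
    exact abs_le.mp (entry_norm_bound_of_unitary hA i j)

/-- The Haar probability measure on the orthogonal group `O(p)`. -/
noncomputable def haarOrthogonal (p : ℕ) : Measure (Matrix.orthogonalGroup (Fin p) ℝ) :=
  Measure.haarMeasure ⊤

/-- The `d × p` matrix formed by the first `d` rows of an orthogonal `p × p` matrix. Under
`haarOrthogonal p` it is a uniformly random `d × p` matrix with orthonormal rows. -/
def firstRows {d p : ℕ} (h : d ≤ p) (Q : Matrix.orthogonalGroup (Fin p) ℝ) :
    Matrix (Fin d) (Fin p) ℝ :=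
  (Q : Matrix (Fin p) (Fin p) ℝ).submatrix (Fin.castLE h) id

/-! ### The data distribution -/

/-- The law of `(x, y)` where `x ∼ N(0, I_p)` and `y = ⟨x, θ⟩ + ε` with `ε ∼ N(0, σ²)`
independent of `x`. -/
noncomputable def dataLaw {p : ℕ} (θ : Fin p → ℝ) (σ : ℝ) : Measure ((Fin p → ℝ) × ℝ) :=
  ((Measure.pi fun _ : Fin p => gaussianReal 0 1).prod
    (gaussianReal 0 (Real.toNNReal (σ ^ 2)))).map
      fun z => (z.1, z.1 ⬝ᵥ θ + z.2)

/-- The law of `n` independent samples `(x_i, y_i)`. -/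
noncomputable def sampleLaw {p : ℕ} (n : ℕ) (θ : Fin p → ℝ) (σ : ℝ) :
    Measure (Fin n → (Fin p → ℝ) × ℝ) :=
  Measure.pi fun _ => dataLaw θ σ

/-- The data matrix `X`, whose rows are the covariates of the samples. -/
def dataMatrix {n p : ℕ} (S : Fin n → (Fin p → ℝ) × ℝ) : Matrix (Fin n) (Fin p) ℝ :=
  Matrix.of fun i => (S i).1

/-- The vector of responses. -/
def responses {n p : ℕ} (S : Fin n → (Fin p → ℝ) × ℝ) : Fin n → ℝ := fun i => (S i).2

/-! ### Ridge regression -/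

/-- The objective `‖Z β - y‖₂² + lam ‖β‖₂²`. -/
def ridgeObjective {n d : ℕ} (lam : ℝ≥0) (Z : Matrix (Fin n) (Fin d) ℝ) (y : Fin n → ℝ)
    (β : Fin d → ℝ) : ℝ :=
  (Z *ᵥ β - y) ⬝ᵥ (Z *ᵥ β - y) + lam * (β ⬝ᵥ β)

/-- `β` minimizes the ridge objective. -/
def IsRidgeMinimizer {n d : ℕ} (lam : ℝ≥0) (Z : Matrix (Fin n) (Fin d) ℝ) (y : Fin n → ℝ)
    (β : Fin d → ℝ) : Prop :=
  ∀ b, ridgeObjective lam Z y β ≤ ridgeObjective lam Z y b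

/-- `β` minimizes the ridge objective and has the least Euclidean norm among all minimizers.
For `lam > 0` the minimizer is unique anyway; for `lam = 0` this selects the minimum-norm least
squares solution. -/
def IsRidgeEstimate {n d : ℕ} (lam : ℝ≥0) (Z : Matrix (Fin n) (Fin d) ℝ) (y : Fin n → ℝ)
    (β : Fin d → ℝ) : Prop :=
  IsRidgeMinimizer lam Z y β ∧ ∀ b, IsRidgeMinimizer lam Z y b → β ⬝ᵥ β ≤ b ⬝ᵥ b

/-- The ridge objective at `β` exceeds its value at a solution `a` of the normal equations
by `‖Z (β - a)‖² + lam ‖β - a‖²`. -/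
theorem ridgeObjective_eq {n d : ℕ} {lam : ℝ≥0} {Z : Matrix (Fin n) (Fin d) ℝ} {y : Fin n → ℝ}
    {a : Fin d → ℝ} (ha : Zᵀ *ᵥ (Z *ᵥ a - y) + (lam : ℝ) • a = 0) (b : Fin d → ℝ) :
    ridgeObjective lam Z y b = ridgeObjective lam Z y a +
      ((Z *ᵥ (b - a)) ⬝ᵥ (Z *ᵥ (b - a)) + lam * ((b - a) ⬝ᵥ (b - a))) := by
  obtain ⟨c, rfl⟩ : ∃ c, b = a + c := ⟨b - a, by simp⟩
  have h : c ⬝ᵥ (Zᵀ *ᵥ (Z *ᵥ a - y)) + lam * (c ⬝ᵥ a) = 0 := by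
    have := congrArg (fun v => c ⬝ᵥ v) ha
    simpa [dotProduct_add, dotProduct_smul] using this
  rw [Matrix.dotProduct_mulVec, Matrix.vecMul_transpose] at h
  have e : Z *ᵥ (a + c) - y = (Z *ᵥ a - y) + Z *ᵥ c := by
    rw [Matrix.mulVec_add]; abel
  unfold ridgeObjective
  rw [e, add_sub_cancel_left]
  simp only [dotProduct_add, add_dotProduct]
  rw [dotProduct_comm (Z *ᵥ a - y) (Z *ᵥ c), dotProduct_comm a c]
  linear_combination 2 * h

/-- The normal equations have a solution orthogonal to the kernel of `ZᵀZ + lam I`. -/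
theorem exists_normal_solution {n d : ℕ} (lam : ℝ≥0) (Z : Matrix (Fin n) (Fin d) ℝ)
    (y : Fin n → ℝ) : ∃ a : Fin d → ℝ, Zᵀ *ᵥ (Z *ᵥ a - y) + (lam : ℝ) • a = 0 ∧
      ∀ v : Fin d → ℝ, Z *ᵥ v = 0 → (lam : ℝ) • v = 0 → a ⬝ᵥ v = 0 := by
  set A : Matrix (Fin d) (Fin d) ℝ := Zᵀ * Z + (lam : ℝ) • 1 with hA
  have hAv : ∀ v, A *ᵥ v = Zᵀ *ᵥ (Z *ᵥ v) + (lam : ℝ) • v := fun v => by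
    simp [hA, Matrix.add_mulVec, Matrix.smul_mulVec, Matrix.mulVec_mulVec]
  have hH : A.IsHermitian := by
    simp [hA, Matrix.IsHermitian, Matrix.conjTranspose_eq_transpose_of_trivial]
  have hS : (Matrix.toEuclideanLin A).IsSymmetric :=
    Matrix.isSymmetric_toEuclideanLin_iff.mpr hH
  have hR : (LinearMap.range (Matrix.toEuclideanLin A)) =
      (LinearMap.ker (Matrix.toEuclideanLin A))ᗮ := by
    rw [← hS.orthogonal_range, Submodule.orthogonal_orthogonal]
  have hker : ∀ v, A *ᵥ v = 0 → Z *ᵥ v = 0 := fun v hv => by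
    have h1 : v ⬝ᵥ (A *ᵥ v) = 0 := by rw [hv, dotProduct_zero]
    rw [hAv, dotProduct_add, Matrix.dotProduct_mulVec, Matrix.vecMul_transpose,
      dotProduct_smul, smul_eq_mul] at h1
    have h2 : 0 ≤ (Z *ᵥ v) ⬝ᵥ (Z *ᵥ v) :=
      Finset.sum_nonneg fun i _ => mul_self_nonneg _
    have h3 : 0 ≤ v ⬝ᵥ v := Finset.sum_nonneg fun i _ => mul_self_nonneg _
    have h4 : 0 ≤ (lam : ℝ) * (v ⬝ᵥ v) := mul_nonneg lam.2 h3
    exact dotProduct_self_eq_zero.mp (by linarith)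
  have hmem : WithLp.toLp 2 (Zᵀ *ᵥ y) ∈ LinearMap.range (Matrix.toEuclideanLin A) := by
    rw [hR, Submodule.mem_orthogonal]
    intro u hu
    have hu' : A *ᵥ (WithLp.ofLp u) = 0 := by
      have := congrArg WithLp.ofLp (LinearMap.mem_ker.mp hu)
      simpa using this
    rw [EuclideanSpace.inner_eq_star_dotProduct]
    simp only [star_trivial]
    rw [dotProduct_comm, Matrix.dotProduct_mulVec, Matrix.vecMul_transpose, hker _ hu',
      zero_dotProduct]
  obtain ⟨w, hw⟩ := hmem
  obtain ⟨k, hk, u, hu, rfl⟩ := Submodule.exists_add_mem_mem_orthogonal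
    (K := LinearMap.ker (Matrix.toEuclideanLin A)) w
  refine ⟨WithLp.ofLp u, ?_, fun v hv1 hv2 => ?_⟩
  · rw [map_add, LinearMap.mem_ker.mp hk, zero_add] at hw
    have := congrArg WithLp.ofLp hw
    simp only [Matrix.ofLp_toLpLin, Matrix.toLin'_apply] at this
    rw [hAv] at this
    rw [Matrix.mulVec_sub, ← this]
    abel
  · have hv : WithLp.toLp 2 v ∈ LinearMap.ker (Matrix.toEuclideanLin A) := by
      rw [LinearMap.mem_ker]
      ext i
      have : A *ᵥ v = 0 := by rw [hAv, hv1, hv2]; simp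
      simp [this]
    have := (Submodule.mem_orthogonal _ _).mp hu _ hv
    rw [EuclideanSpace.inner_eq_star_dotProduct] at this
    simpa using this

theorem exists_isRidgeEstimate {n d : ℕ} (lam : ℝ≥0) (Z : Matrix (Fin n) (Fin d) ℝ)
    (y : Fin n → ℝ) : ∃ β, IsRidgeEstimate lam Z y β := by
  obtain ⟨a, ha, hk⟩ := exists_normal_solution lam Z y
  have h0 : ∀ {m : ℕ} (v : Fin m → ℝ), 0 ≤ v ⬝ᵥ v := fun v =>
    Finset.sum_nonneg fun i _ => mul_self_nonneg _
  have h1 : ∀ v : Fin d → ℝ, 0 ≤ (lam : ℝ) * (v ⬝ᵥ v) := fun v => mul_nonneg lam.2 (h0 v)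
  refine ⟨a, fun b => ?_, fun b hb => ?_⟩
  · rw [ridgeObjective_eq ha b]
    linarith [h0 (Z *ᵥ (b - a)), h1 (b - a)]
  · have h2 := hb a
    rw [ridgeObjective_eq ha b] at h2
    have h3 := h0 (Z *ᵥ (b - a))
    have h4 := h1 (b - a)
    have h5 : Z *ᵥ (b - a) = 0 := dotProduct_self_eq_zero.mp (by linarith)
    have h6 : (lam : ℝ) • (b - a) = 0 := by
      rcases mul_eq_zero.mp (show (lam : ℝ) * ((b - a) ⬝ᵥ (b - a)) = 0 by linarith) with h | h
      · simp [h]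
      · simp [dotProduct_self_eq_zero.mp h]
    have h7 := hk _ h5 h6
    have h8 : b ⬝ᵥ b = a ⬝ᵥ a + 2 * (a ⬝ᵥ (b - a)) + (b - a) ⬝ᵥ (b - a) := by
      simp only [dotProduct_sub, sub_dotProduct, dotProduct_comm b a]; ring
    linarith [h0 (b - a)]

/-- The ridge estimator
`argmin_β ‖Z β - y‖₂² + lam ‖β‖₂²` (the minimum-norm minimizer if `lam = 0`). -/
noncomputable def ridge {n d : ℕ} (lam : ℝ≥0) (Z : Matrix (Fin n) (Fin d) ℝ) (y : Fin n → ℝ) :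
    Fin d → ℝ :=
  Classical.choose (exists_isRidgeEstimate lam Z y)

/-! ### Risks -/

/-- The population risk `R_P(β) = E_{(x, y)} (⟨P x, β⟩ - y)²` of the linear model `β` on the
features `P x`. -/
noncomputable def risk {p d : ℕ} (θ : Fin p → ℝ) (σ : ℝ) (P : Matrix (Fin d) (Fin p) ℝ)
    (β : Fin d → ℝ) : ℝ≥0∞ :=
  ∫⁻ z, ENNReal.ofReal (((P *ᵥ z.1) ⬝ᵥ β - z.2) ^ 2) ∂dataLaw θ σ

/-- The expected risk `E_P E_{X, y} R_P(est(X Pᵀ, y))` of an estimator `est` in the model of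
size `d`. -/
noncomputable def expectedRisk {p d : ℕ} (h : d ≤ p) (n : ℕ) (θ : Fin p → ℝ) (σ : ℝ)
    (est : Matrix (Fin n) (Fin d) ℝ → (Fin n → ℝ) → Fin d → ℝ) : ℝ≥0∞ :=
  ∫⁻ Q, ∫⁻ S, risk θ σ (firstRows h Q)
      (est (dataMatrix S * (firstRows h Q)ᵀ) (responses S))
    ∂sampleLaw n θ σ ∂haarOrthogonal p

/-- The expected risk with optimally tuned ridge parameter: the least expected risk of
`ridge lam` over all `lam ≥ 0`. -/
noncomputable def optimalRisk {p d : ℕ} (h : d ≤ p) (n : ℕ) (θ : Fin p → ℝ) (σ : ℝ) : ℝ≥0∞ :=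
  ⨅ lam : ℝ≥0, expectedRisk h n θ σ (ridge lam)

end ProjRidge

namespace ProjRidge

open Filter Topology

/-! Put τ = |θ|²/p, m = p - d, Z = XPᵀ, and consider any estimator M(Z)y linear in y, with M
measurable. Gaussian rotation invariance moves the random rotation Q from X onto θ: the estimator
then sees the first d columns of a Gaussian matrix, independent of Qθ, whose second moment matrix is
τI. Integrating out ε, Qθ and the m unseen columns gives (`expectedRisk_linear`) R = E_Z[σ² + mτ +
τ‖M(Z)Z - I‖² + (σ² + mτ)‖M(Z)‖²] in Frobenius norms: the discarded covariates act as extra noise of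
variance mτ.

For θ ≠ 0 the integrand is minimized, for each Z separately, by the ridge matrix (ZᵀZ + λI)⁻¹Zᵀ with
λ = (σ² + mτ)/τ (`frobSq_ridgeMatrix_le`). One ridge parameter thus does at least as well as every
linear estimator (`exists_ridge_le_linear`). This gives attainment, and finiteness by comparison
with the zero estimator. For monotonicity, a ridge estimator of size d padded with a zero
coefficient is a linear estimator of size d + 1 with the same risk (`expectedRisk_succ_pad`). For θ
= 0 the optimal risk is σ² for every d, approached as λ → ∞ (`optimalRisk_zero`). -/

/-! ### Ridge regression as a measurable family of linear maps -/

theorem dotProduct_self_nonneg' {ι : Type*} [Fintype ι] (v : ι → ℝ) : 0 ≤ v ⬝ᵥ v :=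
  Finset.sum_nonneg fun _ _ => mul_self_nonneg _

/-- The ridge estimate is the solution of the normal equations that is orthogonal to the kernel. -/
theorem ridge_spec {n d : ℕ} (lam : ℝ≥0) (Z : Matrix (Fin n) (Fin d) ℝ) (y : Fin n → ℝ) :
    Zᵀ *ᵥ (Z *ᵥ ridge lam Z y - y) + (lam : ℝ) • ridge lam Z y = 0 ∧
      ∀ v : Fin d → ℝ, Z *ᵥ v = 0 → (lam : ℝ) • v = 0 → ridge lam Z y ⬝ᵥ v = 0 := by
  obtain ⟨a, ha, hk⟩ := exists_normal_solution lam Z y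
  obtain ⟨hb, hn⟩ := Classical.choose_spec (exists_isRidgeEstimate lam Z y)
  change IsRidgeMinimizer lam Z y (ridge lam Z y) at hb
  change ∀ b, IsRidgeMinimizer lam Z y b → ridge lam Z y ⬝ᵥ ridge lam Z y ≤ b ⬝ᵥ b at hn
  set b := ridge lam Z y
  have h1 : ∀ v : Fin d → ℝ, 0 ≤ (lam : ℝ) * (v ⬝ᵥ v) := fun v =>
    mul_nonneg lam.2 (dotProduct_self_nonneg' v)
  have h2 := hb a
  rw [ridgeObjective_eq ha b] at h2
  have h3 := dotProduct_self_nonneg' (Z *ᵥ (b - a))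
  have h4 := h1 (b - a)
  have h5 : Z *ᵥ (b - a) = 0 := dotProduct_self_eq_zero.mp (by linarith)
  have h6 : (lam : ℝ) • (b - a) = 0 := by
    rcases mul_eq_zero.mp (show (lam : ℝ) * ((b - a) ⬝ᵥ (b - a)) = 0 by linarith) with h | h
    · simp [h]
    · simp [dotProduct_self_eq_zero.mp h]
  have h7 := hk _ h5 h6
  -- Pythagoras: b - a lies in the kernel, to which a is orthogonal. As a is itself a minimizer
  -- (`h9`), the least norm of b forces b = a.
  have h8 : b ⬝ᵥ b = a ⬝ᵥ a + 2 * (a ⬝ᵥ (b - a)) + (b - a) ⬝ᵥ (b - a) := by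
    simp only [dotProduct_sub, sub_dotProduct, dotProduct_comm b a]; ring
  have h9 := hn a fun c => by
    rw [ridgeObjective_eq ha c]
    linarith [dotProduct_self_nonneg' (Z *ᵥ (c - a)), h1 (c - a)]
  have h10 : b - a = 0 := dotProduct_self_eq_zero.mp
    (le_antisymm (by linarith) (dotProduct_self_nonneg' _))
  rw [sub_eq_zero.mp h10]
  exact ⟨ha, hk⟩

/-- The matrix of the ridge estimator with positive ridge parameter. -/
noncomputable def ridgeInv {n d : ℕ} (lam : ℝ) (Z : Matrix (Fin n) (Fin d) ℝ) :
    Matrix (Fin d) (Fin n) ℝ :=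
  (Zᵀ * Z + lam • 1)⁻¹ * Zᵀ

theorem isUnit_det_gram_add {n d : ℕ} {lam : ℝ} (hl : 0 < lam) (Z : Matrix (Fin n) (Fin d) ℝ) :
    IsUnit (Zᵀ * Z + lam • 1).det := by
  rw [isUnit_iff_ne_zero]
  intro h
  obtain ⟨v, hv, h0⟩ := Matrix.exists_mulVec_eq_zero_iff.mpr h
  refine hv (dotProduct_self_eq_zero.mp ?_)
  have h1 := congrArg (fun w => v ⬝ᵥ w) h0
  simp only [Matrix.add_mulVec, Matrix.smul_mulVec, Matrix.one_mulVec, dotProduct_add,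
    dotProduct_smul, smul_eq_mul, dotProduct_zero] at h1
  rw [← Matrix.mulVec_mulVec, Matrix.dotProduct_mulVec, Matrix.vecMul_transpose] at h1
  have h2 := dotProduct_self_nonneg' (Z *ᵥ v)
  have h3 := mul_nonneg hl.le (dotProduct_self_nonneg' v)
  exact (mul_eq_zero.mp (show lam * (v ⬝ᵥ v) = 0 by linarith)).resolve_left hl.ne'

theorem gram_add_mul_ridgeInv {n d : ℕ} {lam : ℝ} (hl : 0 < lam) (Z : Matrix (Fin n) (Fin d) ℝ) :
    (Zᵀ * Z + lam • 1) * ridgeInv lam Z = Zᵀ := by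
  rw [ridgeInv, Matrix.mul_nonsing_inv_cancel_left _ _ (isUnit_det_gram_add hl Z)]

/-- The push-through identity. Read row by row, it is the normal equation of a ridge problem with
design Zᵀ. -/
theorem ridgeInv_mul_gram_add {n d : ℕ} {lam : ℝ} (hl : 0 < lam) (Z : Matrix (Fin n) (Fin d) ℝ) :
    ridgeInv lam Z * (Z * Zᵀ + lam • 1) = Zᵀ := by
  have h : Zᵀ * (Z * Zᵀ + lam • 1) = (Zᵀ * Z + lam • 1) * Zᵀ := by
    rw [Matrix.mul_add, Matrix.add_mul, Matrix.mul_assoc]; simp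
  rw [ridgeInv, Matrix.mul_assoc, h,
    Matrix.nonsing_inv_mul_cancel_left _ _ (isUnit_det_gram_add hl Z)]

theorem ridge_eq_ridgeInv_mulVec {n d : ℕ} {lam : ℝ≥0} (hl : 0 < lam)
    (Z : Matrix (Fin n) (Fin d) ℝ) (y : Fin n → ℝ) :
    ridge lam Z y = ridgeInv (lam : ℝ) Z *ᵥ y := by
  have h := (ridge_spec lam Z y).1
  set a := ridge lam Z y
  have h1 : (Zᵀ * Z + (lam : ℝ) • 1) *ᵥ a = Zᵀ *ᵥ y := by
    rw [Matrix.mulVec_sub, sub_add_eq_add_sub, sub_eq_zero] at h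
    rw [← h, Matrix.add_mulVec, Matrix.smul_mulVec, Matrix.one_mulVec, Matrix.mulVec_mulVec]
  rw [ridgeInv, ← Matrix.mulVec_mulVec, ← h1, Matrix.mulVec_mulVec,
    Matrix.nonsing_inv_mul _ (isUnit_det_gram_add (NNReal.coe_pos.mpr hl) Z), Matrix.one_mulVec]

/-- Fits a by least squares with design Zᵀ. The residual is killed by Z, so it is orthogonal both to
the range of Zᵀ and, by hypothesis, to a; hence it vanishes. -/
theorem exists_transpose_mulVec_eq {n d : ℕ} {Z : Matrix (Fin n) (Fin d) ℝ} {a : Fin d → ℝ}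
    (ha : ∀ v, Z *ᵥ v = 0 → a ⬝ᵥ v = 0) : ∃ u, Zᵀ *ᵥ u = a := by
  obtain ⟨u, hu, -⟩ := exists_normal_solution 0 Zᵀ a
  simp only [Matrix.transpose_transpose, NNReal.coe_zero, zero_smul, add_zero] at hu
  refine ⟨u, sub_eq_zero.mp (dotProduct_self_eq_zero.mp ?_)⟩
  rw [sub_dotProduct, ha _ hu, sub_zero, Matrix.mulVec_transpose, ← Matrix.dotProduct_mulVec,
    ← Matrix.mulVec_transpose, hu, dotProduct_zero]

/-- The distance of the ridge estimate from the minimum norm least squares solution. -/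
theorem exists_ridgeInv_sub_ridge_zero_le {n d : ℕ} (Z : Matrix (Fin n) (Fin d) ℝ)
    (y : Fin n → ℝ) : ∃ C : ℝ, ∀ lam : ℝ, 0 < lam →
      (ridgeInv lam Z *ᵥ y - ridge 0 Z y) ⬝ᵥ (ridgeInv lam Z *ᵥ y - ridge 0 Z y) ≤ C * lam := by
  obtain ⟨h, hk⟩ := ridge_spec 0 Z y
  set a := ridge 0 Z y
  obtain ⟨u, hu⟩ := exists_transpose_mulVec_eq fun v hv => hk v hv (by simp)
  -- With a = Zᵀu and e the error, the normal equations give |Ze|² + λ|e|² = -λ⟨Ze, u⟩. Completing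
  -- the square, |Ze + (λ/2)u|² ≥ 0, yields λ|e|² ≤ λ²|u|²/4.
  refine ⟨(u ⬝ᵥ u) / 4, fun lam hl => ?_⟩
  obtain ⟨e, he⟩ : ∃ e, ridgeInv lam Z *ᵥ y = a + e := ⟨ridgeInv lam Z *ᵥ y - a, by simp⟩
  rw [he, add_sub_cancel_left]
  have h1 : (Zᵀ * Z + lam • 1) *ᵥ (a + e) = Zᵀ *ᵥ (Z *ᵥ a) := by
    rw [← he, Matrix.mulVec_mulVec, gram_add_mul_ridgeInv hl]
    simp only [NNReal.coe_zero, zero_smul, add_zero, Matrix.mulVec_sub] at h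
    exact (sub_eq_zero.mp h).symm
  rw [Matrix.mulVec_add, Matrix.add_mulVec, Matrix.add_mulVec, Matrix.smul_mulVec,
    Matrix.smul_mulVec, Matrix.one_mulVec, Matrix.one_mulVec, ← Matrix.mulVec_mulVec,
    ← Matrix.mulVec_mulVec] at h1
  have h2 := congrArg (fun v => e ⬝ᵥ v) h1
  simp only [dotProduct_add, dotProduct_smul, smul_eq_mul] at h2
  rw [← hu, Matrix.dotProduct_mulVec e Zᵀ u, Matrix.vecMul_transpose,
    Matrix.dotProduct_mulVec e Zᵀ (Z *ᵥ e), Matrix.vecMul_transpose] at h2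
  have h3 := dotProduct_self_nonneg' (Z *ᵥ e + (lam / 2) • u)
  simp only [dotProduct_add, add_dotProduct, dotProduct_smul, smul_dotProduct, smul_eq_mul,
    dotProduct_comm u (Z *ᵥ e)] at h3
  have h4 : lam * (e ⬝ᵥ e) ≤ lam * ((u ⬝ᵥ u) / 4 * lam) := by linarith
  exact le_of_mul_le_mul_left h4 hl

/-- Exhibits the minimum-norm solution, defined by choice, as a limit of explicit formulas;
linearity in y and measurability in Z for λ = 0 are inherited from them. -/
theorem tendsto_ridgeInv_mulVec {n d : ℕ} (Z : Matrix (Fin n) (Fin d) ℝ) (y : Fin n → ℝ) :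
    Tendsto (fun k : ℕ => ridgeInv (1 / ((k : ℝ) + 1)) Z *ᵥ y) atTop (𝓝 (ridge 0 Z y)) := by
  obtain ⟨C, hC⟩ := exists_ridgeInv_sub_ridge_zero_le Z y
  rw [tendsto_pi_nhds]
  intro i
  rw [tendsto_iff_dist_tendsto_zero]
  have h0 : Tendsto (fun k : ℕ => √(C * (1 / ((k : ℝ) + 1)))) atTop (𝓝 0) := by
    have := (tendsto_one_div_add_atTop_nhds_zero_nat (𝕜 := ℝ)).const_mul C
    simpa using this.sqrt
  refine squeeze_zero (fun _ => dist_nonneg) (fun k => ?_) h0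
  rw [Real.dist_eq]
  refine Real.abs_le_sqrt (le_trans ?_ (hC _ Nat.one_div_pos_of_nat))
  rw [sq]
  exact Finset.single_le_sum (f := fun i => (ridgeInv (1 / ((k : ℝ) + 1)) Z *ᵥ y - ridge 0 Z y) i *
    (ridgeInv (1 / ((k : ℝ) + 1)) Z *ᵥ y - ridge 0 Z y) i)
    (fun _ _ => mul_self_nonneg _) (Finset.mem_univ i)

/-- The matrix of the linear map `ridge lam Z`. -/
noncomputable def ridgeMatrix {n d : ℕ} (lam : ℝ≥0) (Z : Matrix (Fin n) (Fin d) ℝ) :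
    Matrix (Fin d) (Fin n) ℝ :=
  Matrix.of fun i j => ridge lam Z (Pi.single j 1) i

theorem ridgeMatrix_eq_ridgeInv {n d : ℕ} {lam : ℝ≥0} (hl : 0 < lam)
    (Z : Matrix (Fin n) (Fin d) ℝ) : ridgeMatrix lam Z = ridgeInv (lam : ℝ) Z := by
  ext i j
  simp [ridgeMatrix, ridge_eq_ridgeInv_mulVec hl]

theorem tendsto_ridgeInv {n d : ℕ} (Z : Matrix (Fin n) (Fin d) ℝ) :
    Tendsto (fun k : ℕ => ridgeInv (1 / ((k : ℝ) + 1)) Z) atTop (𝓝 (ridgeMatrix 0 Z)) := by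
  refine tendsto_pi_nhds.mpr fun i => tendsto_pi_nhds.mpr fun j => ?_
  have := tendsto_pi_nhds.mp (tendsto_ridgeInv_mulVec Z (Pi.single j 1)) i
  simpa [ridgeMatrix] using this

theorem ridge_eq_ridgeMatrix_mulVec {n d : ℕ} (lam : ℝ≥0) (Z : Matrix (Fin n) (Fin d) ℝ)
    (y : Fin n → ℝ) : ridge lam Z y = ridgeMatrix lam Z *ᵥ y := by
  rcases eq_zero_or_pos lam with rfl | hl
  · refine tendsto_nhds_unique (tendsto_ridgeInv_mulVec Z y) ?_
    exact ((Continuous.matrix_mulVec continuous_id continuous_const).tendsto _).comp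
      (tendsto_ridgeInv Z)
  · rw [ridge_eq_ridgeInv_mulVec hl, ridgeMatrix_eq_ridgeInv hl]

theorem measurable_ridgeInv {n d : ℕ} (lam : ℝ) (i : Fin d) (j : Fin n) :
    Measurable fun Z : Fin n → Fin d → ℝ => ridgeInv lam (Matrix.of Z) i j := by
  have hA : Continuous fun Z : Fin n → Fin d → ℝ =>
      (Matrix.of Z)ᵀ * Matrix.of Z + lam • (1 : Matrix (Fin d) (Fin d) ℝ) := by
    have : Continuous fun Z : Fin n → Fin d → ℝ => Matrix.of Z := continuous_id
    fun_prop
  have hB : Continuous fun Z : Fin n → Fin d → ℝ =>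
      ((Matrix.of Z)ᵀ * Matrix.of Z + lam • (1 : Matrix (Fin d) (Fin d) ℝ)).adjugate *
        (Matrix.of Z)ᵀ := by
    have : Continuous fun Z : Fin n → Fin d → ℝ => Matrix.of Z := continuous_id
    fun_prop
  -- Cramer's rule: determinant and adjugate are continuous in Z, and scalar inversion is measurable
  -- everywhere, including at 0.
  have : ∀ Z : Fin n → Fin d → ℝ, ridgeInv lam (Matrix.of Z) i j =
      (((Matrix.of Z)ᵀ * Matrix.of Z + lam • (1 : Matrix (Fin d) (Fin d) ℝ)).det)⁻¹ *
      (((Matrix.of Z)ᵀ * Matrix.of Z + lam • (1 : Matrix (Fin d) (Fin d) ℝ)).adjugate *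
        (Matrix.of Z)ᵀ) i j := fun Z => by
    rw [ridgeInv, Matrix.inv_def, Ring.inverse_eq_inv', Matrix.smul_mul, Matrix.smul_apply,
      smul_eq_mul]
  simp only [this]
  exact (hA.matrix_det.measurable.inv).mul (hB.matrix_elem i j).measurable

theorem measurable_ridgeMatrix {n d : ℕ} (lam : ℝ≥0) (i : Fin d) (j : Fin n) :
    Measurable fun Z : Fin n → Fin d → ℝ => ridgeMatrix lam (Matrix.of Z) i j := by
  rcases eq_zero_or_pos lam with rfl | hl
  · refine measurable_of_tendsto_metrizable
      (fun k : ℕ => measurable_ridgeInv (1 / ((k : ℝ) + 1)) i j) (tendsto_pi_nhds.mpr fun Z => ?_)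
    exact tendsto_pi_nhds.mp (tendsto_pi_nhds.mp (tendsto_ridgeInv (Matrix.of Z)) i) j
  · simp only [ridgeMatrix_eq_ridgeInv hl]
    exact measurable_ridgeInv _ i j

/-! ### The variational characterization of the ridge matrix -/

/-- The squared Frobenius norm. -/
def frobSq {ι κ : Type*} [Fintype ι] [Fintype κ] (A : Matrix ι κ ℝ) : ℝ := ∑ i, A i ⬝ᵥ A i

theorem frobSq_nonneg {ι κ : Type*} [Fintype ι] [Fintype κ] (A : Matrix ι κ ℝ) : 0 ≤ frobSq A :=
  Finset.sum_nonneg fun _ _ => dotProduct_self_nonneg' _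

/-- The Frobenius problem decouples over the rows of M: row i solves a ridge problem with design Zᵀ
and target the i-th basis vector. -/
theorem sum_ridgeObjective_transpose {n d : ℕ} (lam : ℝ≥0) (Z : Matrix (Fin n) (Fin d) ℝ)
    (M : Matrix (Fin d) (Fin n) ℝ) :
    ∑ i, ridgeObjective lam Zᵀ (Pi.single i 1) (M i) = frobSq (M * Z - 1) + lam * frobSq M := by
  rw [frobSq, frobSq, Finset.mul_sum, ← Finset.sum_add_distrib]
  refine Finset.sum_congr rfl fun i _ => ?_
  have : Zᵀ *ᵥ M i - Pi.single i 1 = (M * Z - 1 : Matrix _ _ ℝ) i := by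
    ext j
    simp [Matrix.mulVec_transpose, Matrix.vecMul, Matrix.mul_apply, dotProduct, Matrix.one_apply,
      Pi.single_apply, eq_comm]
  rw [ridgeObjective, this]

/-- The ridge matrix is the minimizer of a regularized squared Frobenius distance. -/
theorem frobSq_ridgeMatrix_le {n d : ℕ} {lam : ℝ≥0} (hl : 0 < lam) (Z : Matrix (Fin n) (Fin d) ℝ)
    (M : Matrix (Fin d) (Fin n) ℝ) :
    frobSq (ridgeMatrix lam Z * Z - 1) + lam * frobSq (ridgeMatrix lam Z) ≤
      frobSq (M * Z - 1) + lam * frobSq M := by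
  rw [← sum_ridgeObjective_transpose, ← sum_ridgeObjective_transpose]
  refine Finset.sum_le_sum fun i _ => ?_
  have h : Zᵀᵀ *ᵥ (Zᵀ *ᵥ (ridgeMatrix lam Z i) - Pi.single i 1) +
      (lam : ℝ) • ridgeMatrix lam Z i = 0 := by
    have h1 := congrFun (ridgeInv_mul_gram_add (NNReal.coe_pos.mpr hl) Z) i
    rw [← ridgeMatrix_eq_ridgeInv hl, Matrix.mul_apply_eq_vecMul, Matrix.vecMul_add,
      Matrix.vecMul_smul, Matrix.vecMul_one, ← Matrix.vecMul_vecMul] at h1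
    rw [Matrix.mulVec_sub, Matrix.transpose_transpose, Matrix.mulVec_transpose,
      ← Matrix.vecMul_transpose, sub_add_eq_add_sub, h1, sub_eq_zero]
    ext k
    simp
  rw [ridgeObjective_eq h (M i)]
  have h2 : 0 ≤ (lam : ℝ) * ((M i - ridgeMatrix lam Z i) ⬝ᵥ (M i - ridgeMatrix lam Z i)) :=
    mul_nonneg lam.2 (dotProduct_self_nonneg' _)
  linarith [dotProduct_self_nonneg' (Zᵀ *ᵥ (M i - ridgeMatrix lam Z i))]

/-! ### Gaussian second moments and invariances -/

theorem lintegral_ofReal_add_sum {Ω ι : Type*} [MeasurableSpace Ω] [Fintype ι] {μ : Measure Ω}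
    [IsProbabilityMeasure μ] {b : ℝ} (hb : 0 ≤ b) {f : ι → Ω → ℝ} {g : ι → ℝ}
    (hf : ∀ i, Measurable (f i)) (hf0 : ∀ i ω, 0 ≤ f i ω) (hg0 : ∀ i, 0 ≤ g i)
    (h : ∀ i, ∫⁻ ω, ENNReal.ofReal (f i ω) ∂μ = ENNReal.ofReal (g i)) :
    ∫⁻ ω, ENNReal.ofReal (b + ∑ i, f i ω) ∂μ = ENNReal.ofReal (b + ∑ i, g i) := by
  have h1 : ∀ ω, ENNReal.ofReal (b + ∑ i, f i ω) =
      ENNReal.ofReal b + ∑ i, ENNReal.ofReal (f i ω) := fun ω => by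
    rw [ENNReal.ofReal_add hb (Finset.sum_nonneg fun i _ => hf0 i ω),
      ENNReal.ofReal_sum_of_nonneg fun i _ => hf0 i ω]
  simp only [h1]
  rw [lintegral_add_left measurable_const,
    lintegral_finsetSum _ fun i _ => (hf i).ennreal_ofReal,
    ENNReal.ofReal_add hb (Finset.sum_nonneg fun i _ => hg0 i),
    ENNReal.ofReal_sum_of_nonneg fun i _ => hg0 i]
  simp [h]

theorem lintegral_add_sq {Ω : Type*} [MeasurableSpace Ω] {μ : Measure Ω} [IsProbabilityMeasure μ]
    {Y : Ω → ℝ} (hY : MemLp Y 2 μ) (hm : ∫ ω, Y ω ∂μ = 0) (a : ℝ) :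
    ∫⁻ ω, ENNReal.ofReal ((a + Y ω) ^ 2) ∂μ = ENNReal.ofReal (a ^ 2 + Var[Y; μ]) := by
  have h2 : Integrable (fun ω => Y ω ^ 2) μ := hY.integrable_sq
  have h1 : Integrable Y μ := hY.integrable one_le_two
  have e : ∀ ω, (a + Y ω) ^ 2 = a ^ 2 + (2 * a) * Y ω + Y ω ^ 2 := fun ω => by ring
  have hi : Integrable (fun ω => a ^ 2 + (2 * a) * Y ω) μ :=
    (integrable_const _).add (h1.const_mul _)
  rw [← ofReal_integral_eq_lintegral_ofReal]
  · rw [variance_of_integral_eq_zero hY.aestronglyMeasurable.aemeasurable hm]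
    simp only [e]
    rw [integral_add hi h2, integral_add (integrable_const _) (h1.const_mul _),
      integral_const_mul, hm]
    simp
  · simp only [e]
    exact hi.add h2
  · exact ae_of_all _ fun ω => sq_nonneg _

theorem memLp_two_gaussianReal (m : ℝ) (v : ℝ≥0) : MemLp (fun x : ℝ => x) 2 (gaussianReal m v) :=
  memLp_id_gaussianReal' 2 (by simp)

theorem lintegral_add_sq_gaussianReal (v : ℝ≥0) (a : ℝ) :
    ∫⁻ e, ENNReal.ofReal ((a + e) ^ 2) ∂gaussianReal 0 v = ENNReal.ofReal (a ^ 2 + v) := by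
  rw [lintegral_add_sq (memLp_two_gaussianReal 0 v) (by simp) a]
  congr 2
  exact variance_id_gaussianReal

theorem lintegral_add_dotProduct_sq {ι : Type*} [Fintype ι] (v : ℝ≥0) (a : ℝ) (c : ι → ℝ) :
    ∫⁻ w, ENNReal.ofReal ((a + c ⬝ᵥ w) ^ 2) ∂(Measure.pi fun _ : ι => gaussianReal 0 v) =
      ENNReal.ofReal (a ^ 2 + v * (c ⬝ᵥ c)) := by
  have hX : ∀ i, MemLp (fun x : ℝ => c i * x) 2 (gaussianReal 0 v) := fun i =>
    (memLp_two_gaussianReal 0 v).const_mul _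
  have hXi : ∀ i, MemLp (fun w : ι → ℝ => c i * w i) 2
      (Measure.pi fun _ : ι => gaussianReal 0 v) := fun i =>
    (hX i).comp_measurePreserving (measurePreserving_eval (fun _ : ι => gaussianReal 0 v) i)
  have hm : ∀ i, ∫ w : ι → ℝ, c i * w i ∂(Measure.pi fun _ : ι => gaussianReal 0 v) = 0 := by
    intro i
    have h := (measurePreserving_eval (fun _ : ι => gaussianReal 0 v) i)
    have h1 := integral_map (μ := Measure.pi fun _ : ι => gaussianReal 0 v) (φ := Function.eval i)
      h.measurable.aemeasurable (f := fun x : ℝ => c i * x) (by fun_prop)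
    rw [h.map_eq] at h1
    simp only [Function.eval] at h1
    rw [← h1, integral_const_mul]
    simp
  have e : (fun w : ι → ℝ => c ⬝ᵥ w) = ∑ i, fun w : ι → ℝ => c i * w i := by
    ext w; simp [dotProduct]
  have h2 : MemLp (fun w : ι → ℝ => c ⬝ᵥ w) 2 (Measure.pi fun _ : ι => gaussianReal 0 v) := by
    rw [e]; exact memLp_finsetSum' _ fun i _ => hXi i
  rw [lintegral_add_sq h2]
  · congr 2
    rw [e, variance_sum_pi hX, dotProduct, Finset.mul_sum]
    refine Finset.sum_congr rfl fun i _ => ?_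
    rw [variance_const_mul]
    have : Var[fun x : ℝ => x; gaussianReal 0 v] = v := variance_id_gaussianReal
    rw [this]; ring
  · simp only [dotProduct]
    rw [integral_finsetSum _ fun i _ => (hXi i).integrable one_le_two]
    simp [hm]

/-- The law of an `n × p` matrix with independent standard Gaussian entries. -/
noncomputable def gaussMat (n p : ℕ) : Measure (Fin n → Fin p → ℝ) :=
  Measure.pi fun _ => Measure.pi fun _ => gaussianReal 0 1

instance instIsProbabilityMeasureGaussMat (n p : ℕ) : IsProbabilityMeasure (gaussMat n p) := by
  unfold gaussMat; infer_instance

/-- Integrates out the label noise: the cross term vanishes because w is centred, leaving bias plus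
variance. -/
theorem lintegral_add_mulVec {ι κ : Type*} [Fintype ι] [Fintype κ] (v : ℝ≥0) {b : ℝ} (hb : 0 ≤ b)
    (a : κ → ℝ) (B : Matrix κ ι ℝ) :
    ∫⁻ w, ENNReal.ofReal (b + (a + B *ᵥ w) ⬝ᵥ (a + B *ᵥ w))
      ∂(Measure.pi fun _ : ι => gaussianReal 0 v) =
      ENNReal.ofReal (b + (a ⬝ᵥ a + v * frobSq B)) := by
  have e : ∀ w, (a + B *ᵥ w) ⬝ᵥ (a + B *ᵥ w) = ∑ i, (a i + B i ⬝ᵥ w) ^ 2 := fun w => by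
    simp only [dotProduct, sq]; rfl
  simp only [e]
  rw [lintegral_ofReal_add_sum hb (g := fun i => a i ^ 2 + v * (B i ⬝ᵥ B i))]
  · congr 2
    rw [Finset.sum_add_distrib, frobSq, Finset.mul_sum]
    simp [dotProduct, sq]
  · intro i
    have : Continuous fun w => a i + B i ⬝ᵥ w := by
      unfold dotProduct; fun_prop
    exact (this.pow 2).measurable
  · exact fun i w => sq_nonneg _
  · exact fun i => add_nonneg (sq_nonneg _) (mul_nonneg v.2 (dotProduct_self_nonneg' _))
  · exact fun i => lintegral_add_dotProduct_sq v (a i) (B i)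

/-- Integrates out the covariates that the model does not see: each of the m columns of W is
standard Gaussian and contributes ‖M‖². -/
theorem lintegral_frobSq_mul {n m : ℕ} {κ : Type*} [Fintype κ] {b : ℝ} (hb : 0 ≤ b)
    (M : Matrix κ (Fin n) ℝ) :
    ∫⁻ W, ENNReal.ofReal (b + frobSq (M * Matrix.of W)) ∂gaussMat n m =
      ENNReal.ofReal (b + m * frobSq M) := by
  have e : ∀ W : Fin n → Fin m → ℝ, frobSq (M * Matrix.of W) =
      ∑ q : κ × Fin m, (0 + M q.1 ⬝ᵥ fun k => W k q.2) ^ 2 := fun W => by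
    rw [Fintype.sum_prod_type]
    simp [frobSq, dotProduct, sq, Matrix.mul_apply]
  simp only [e]
  rw [lintegral_ofReal_add_sum hb (g := fun q => M q.1 ⬝ᵥ M q.1)]
  · congr 2
    rw [Fintype.sum_prod_type]
    simp [frobSq, Finset.mul_sum]
  · intro q
    have : Continuous fun W : Fin n → Fin m → ℝ => 0 + M q.1 ⬝ᵥ fun k => W k q.2 := by
      unfold dotProduct; fun_prop
    exact (this.pow 2).measurable
  · exact fun i w => sq_nonneg _
  · exact fun i => dotProduct_self_nonneg' _
  · intro q
    have h : MeasurePreserving (fun (W : Fin n → Fin m → ℝ) k => W k q.2) (gaussMat n m)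
        (Measure.pi fun _ : Fin n => gaussianReal 0 1) :=
      measurePreserving_pi _ _ fun _ =>
        measurePreserving_eval (fun _ : Fin m => gaussianReal 0 1) q.2
    have h1 := lintegral_add_dotProduct_sq 1 0 (M q.1)
    rw [← h.lintegral_comp (f := fun w => ENNReal.ofReal ((0 + M q.1 ⬝ᵥ w) ^ 2))] at h1
    · simpa using h1
    · have : Continuous fun w => 0 + M q.1 ⬝ᵥ w := by
        unfold dotProduct; fun_prop
      exact (this.pow 2).measurable.ennreal_ofReal

/-- The columns of a Gaussian matrix can be split into two independent Gaussian matrices. -/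
theorem measurePreserving_split (n d m : ℕ) :
    MeasurePreserving (fun X : Fin n → Fin (d + m) → ℝ =>
      ((fun k j => X k (Fin.castAdd m j) : Fin n → Fin d → ℝ),
        (fun k j => X k (Fin.natAdd d j) : Fin n → Fin m → ℝ)))
      (gaussMat n (d + m)) ((gaussMat n d).prod (gaussMat n m)) := by
  have h1 : MeasurePreserving (fun x : Fin (d + m) → ℝ =>
      ((fun j => x (Fin.castAdd m j) : Fin d → ℝ), (fun j => x (Fin.natAdd d j) : Fin m → ℝ)))
      (Measure.pi fun _ => gaussianReal 0 1)
      ((Measure.pi fun _ => gaussianReal 0 1).prod (Measure.pi fun _ => gaussianReal 0 1)) :=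
    (measurePreserving_sumPiEquivProdPi fun _ : Fin d ⊕ Fin m => gaussianReal 0 1).comp
      (measurePreserving_piCongrLeft (fun _ : Fin (d + m) => gaussianReal 0 1)
        finSumFinEquiv).symm
  exact (measurePreserving_arrowProdEquivProdArrow _ _ (Fin n) _ _).comp
    (measurePreserving_pi _ _ fun _ : Fin n => h1)

/-- Standard Gaussian vectors are rotation invariant. -/
theorem measurePreserving_orthogonal {p : ℕ} (Q : Matrix.orthogonalGroup (Fin p) ℝ) :
    MeasurePreserving (fun x : Fin p → ℝ => (Q : Matrix (Fin p) (Fin p) ℝ) *ᵥ x)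
      (Measure.pi fun _ => gaussianReal 0 1) (Measure.pi fun _ => gaussianReal 0 1) := by
  have hc : Continuous fun x : Fin p → ℝ => (Q : Matrix (Fin p) (Fin p) ℝ) *ᵥ x := by fun_prop
  refine ⟨hc.measurable, ?_⟩
  have hQ : (Q : Matrix (Fin p) (Fin p) ℝ)ᵀ * (Q : Matrix (Fin p) (Fin p) ℝ) = 1 :=
    (Matrix.mem_orthogonalGroup_iff' (Fin p) ℝ).mp Q.2
  let f : EuclideanSpace ℝ (Fin p) →ₗᵢ[ℝ] EuclideanSpace ℝ (Fin p) :=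
    (Matrix.toEuclideanLin (Q : Matrix (Fin p) (Fin p) ℝ)).isometryOfInner fun x y => by
      rw [EuclideanSpace.inner_eq_star_dotProduct, EuclideanSpace.inner_eq_star_dotProduct]
      simp only [star_trivial, Matrix.ofLp_toLpLin, Matrix.toLin'_apply]
      rw [Matrix.dotProduct_mulVec, Matrix.vecMul_mulVec, hQ, Matrix.vecMul_one]
  have h1 := stdGaussian_map (f.toLinearIsometryEquiv rfl)
  rw [← map_pi_eq_stdGaussian, Measure.map_map (by fun_prop) (by fun_prop)] at h1
  have h2 := congrArg (Measure.map (WithLp.ofLp (p := 2) (V := Fin p → ℝ))) h1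
  rw [Measure.map_map (by fun_prop) (by fun_prop), Measure.map_map (by fun_prop) (by fun_prop)]
    at h2
  simpa [Function.comp_def, f] using h2

theorem measurePreserving_gaussMat_mul {n p : ℕ} (Q : Matrix.orthogonalGroup (Fin p) ℝ) :
    MeasurePreserving (fun (X : Fin n → Fin p → ℝ) k => (Q : Matrix (Fin p) (Fin p) ℝ) *ᵥ X k)
      (gaussMat n p) (gaussMat n p) :=
  measurePreserving_pi _ _ fun _ => measurePreserving_orthogonal Q

/-- The prediction error is, up to sign, ⟨θ - Pᵀβ, x⟩ + ε, a sum of independent centred Gaussians,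
so its variances add. -/
theorem risk_eq {p d : ℕ} (θ : Fin p → ℝ) (σ : ℝ) (P : Matrix (Fin d) (Fin p) ℝ)
    (β : Fin d → ℝ) :
    risk θ σ P β = ENNReal.ofReal (σ ^ 2 + (θ - Pᵀ *ᵥ β) ⬝ᵥ (θ - Pᵀ *ᵥ β)) := by
  have hc : Continuous fun z : (Fin p → ℝ) × ℝ => ((P *ᵥ z.1) ⬝ᵥ β - z.2) ^ 2 := by
    unfold dotProduct; fun_prop
  have hd : Continuous fun z : (Fin p → ℝ) × ℝ => (z.1, z.1 ⬝ᵥ θ + z.2) := by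
    unfold dotProduct; fun_prop
  rw [risk, dataLaw, lintegral_map hc.measurable.ennreal_ofReal hd.measurable,
    lintegral_prod]
  swap
  · exact (hc.comp hd).measurable.ennreal_ofReal.aemeasurable
  have e : ∀ (x : Fin p → ℝ) (ε : ℝ), ((P *ᵥ x) ⬝ᵥ β - (x ⬝ᵥ θ + ε)) ^ 2 =
      ((θ - Pᵀ *ᵥ β) ⬝ᵥ x + ε) ^ 2 := fun x ε => by
    have : (P *ᵥ x) ⬝ᵥ β = (Pᵀ *ᵥ β) ⬝ᵥ x := by
      rw [dotProduct_comm, Matrix.dotProduct_mulVec, Matrix.mulVec_transpose]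
    rw [this, sub_dotProduct, dotProduct_comm x θ]; ring
  simp only [e, lintegral_add_sq_gaussianReal]
  have h := lintegral_ofReal_add_sum (μ := Measure.pi fun _ : Fin p => gaussianReal 0 1)
    (ι := Unit) (b := ((σ ^ 2).toNNReal : ℝ)) (NNReal.coe_nonneg _)
    (f := fun _ x => (0 + (θ - Pᵀ *ᵥ β) ⬝ᵥ x) ^ 2)
    (g := fun _ => 0 ^ 2 + ((1 : ℝ≥0) : ℝ) * ((θ - Pᵀ *ᵥ β) ⬝ᵥ (θ - Pᵀ *ᵥ β)))
    (fun _ => by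
      have : Continuous fun x => 0 + (θ - Pᵀ *ᵥ β) ⬝ᵥ x := by unfold dotProduct; fun_prop
      exact (this.pow 2).measurable)
    (fun _ _ => sq_nonneg _)
    (fun _ => by simpa using dotProduct_self_nonneg' (θ - Pᵀ *ᵥ β))
    (fun _ => lintegral_add_dotProduct_sq 1 0 _)
  simpa [add_comm, Real.coe_toNNReal _ (sq_nonneg σ)] using h

theorem measurePreserving_sample {p : ℕ} (n : ℕ) (θ : Fin p → ℝ) (σ : ℝ) :
    MeasurePreserving (fun (z : (Fin n → Fin p → ℝ) × (Fin n → ℝ)) k =>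
        (z.1 k, z.1 k ⬝ᵥ θ + z.2 k))
      ((gaussMat n p).prod (Measure.pi fun _ => gaussianReal 0 (σ ^ 2).toNNReal))
      (sampleLaw n θ σ) := by
  have hd : Continuous fun z : (Fin p → ℝ) × ℝ => (z.1, z.1 ⬝ᵥ θ + z.2) := by
    unfold dotProduct; fun_prop
  have h1 : MeasurePreserving (fun z : (Fin p → ℝ) × ℝ => (z.1, z.1 ⬝ᵥ θ + z.2))
      ((Measure.pi fun _ : Fin p => gaussianReal 0 1).prod (gaussianReal 0 (σ ^ 2).toNNReal))
      (dataLaw θ σ) := ⟨hd.measurable, rfl⟩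
  have : IsProbabilityMeasure (dataLaw θ σ) := 
    Measure.isProbabilityMeasure_map hd.measurable.aemeasurable
  exact (measurePreserving_pi _ _ fun _ : Fin n => h1).comp
    (measurePreserving_arrowProdEquivProdArrow _ _ (Fin n) _ _).symm

/-! ### Second moments of a uniformly random rotation of a vector -/

instance instIsProbabilityMeasureHaarOrthogonal (p : ℕ) :
    IsProbabilityMeasure (haarOrthogonal p) :=
  ⟨by simpa [haarOrthogonal] using
    Measure.haarMeasure_self (K₀ := (⊤ : TopologicalSpace.PositiveCompacts
      (Matrix.orthogonalGroup (Fin p) ℝ)))⟩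

instance instIsMulLeftInvariantHaarOrthogonal (p : ℕ) :
    (haarOrthogonal p).IsMulLeftInvariant := by
  unfold haarOrthogonal; infer_instance

theorem continuous_orthogonal_mulVec {p : ℕ} (θ : Fin p → ℝ) :
    Continuous fun Q : Matrix.orthogonalGroup (Fin p) ℝ =>
      (Q : Matrix (Fin p) (Fin p) ℝ) *ᵥ θ :=
  Continuous.matrix_mulVec continuous_subtype_val continuous_const

theorem orthogonal_mulVec_dotProduct_self {p : ℕ} (Q : Matrix.orthogonalGroup (Fin p) ℝ)
    (v : Fin p → ℝ) :
    ((Q : Matrix (Fin p) (Fin p) ℝ) *ᵥ v) ⬝ᵥ ((Q : Matrix (Fin p) (Fin p) ℝ) *ᵥ v) = v ⬝ᵥ v := by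
  have hQ : (Q : Matrix (Fin p) (Fin p) ℝ)ᵀ * (Q : Matrix (Fin p) (Fin p) ℝ) = 1 :=
    (Matrix.mem_orthogonalGroup_iff' (Fin p) ℝ).mp Q.2
  rw [Matrix.dotProduct_mulVec, Matrix.vecMul_mulVec, hQ, Matrix.vecMul_one]

theorem integral_haarOrthogonal_mul_left {p : ℕ} (θ : Fin p → ℝ)
    (g : Matrix.orthogonalGroup (Fin p) ℝ) (f : (Fin p → ℝ) → ℝ) :
    ∫ Q, f ((g : Matrix (Fin p) (Fin p) ℝ) *ᵥ ((Q : Matrix (Fin p) (Fin p) ℝ) *ᵥ θ))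
      ∂haarOrthogonal p = ∫ Q, f ((Q : Matrix (Fin p) (Fin p) ℝ) *ᵥ θ) ∂haarOrthogonal p := by
  rw [← integral_mul_left_eq_self (μ := haarOrthogonal p)
    (fun Q => f ((Q : Matrix (Fin p) (Fin p) ℝ) *ᵥ θ)) g]
  simp [Matrix.mulVec_mulVec]

theorem integral_haarOrthogonal_mul_of_ne {p : ℕ} (θ : Fin p → ℝ) {i j : Fin p} (hij : i ≠ j) :
    ∫ Q, ((Q : Matrix (Fin p) (Fin p) ℝ) *ᵥ θ) i * ((Q : Matrix (Fin p) (Fin p) ℝ) *ᵥ θ) j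
      ∂haarOrthogonal p = 0 := by
  -- Flipping the sign of coordinate i preserves Haar measure and negates the integrand.
  let s : Fin p → ℝ := fun k => if k = i then -1 else 1
  have hs : Matrix.diagonal s ∈ Matrix.orthogonalGroup (Fin p) ℝ := by
    rw [Matrix.mem_orthogonalGroup_iff, Matrix.diagonal_transpose, Matrix.diagonal_mul_diagonal,
      ← Matrix.diagonal_one]
    congr 1
    ext k
    by_cases hk : k = i <;> simp [s, hk]
  have h := integral_haarOrthogonal_mul_left θ ⟨_, hs⟩ fun u => u i * u j
  simp only [Matrix.mulVec_diagonal, s, if_true, if_neg hij.symm, one_mul, neg_mul,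
    integral_neg] at h
  linarith

theorem integral_haarOrthogonal_mul_self_eq {p : ℕ} (θ : Fin p → ℝ) (i j : Fin p) :
    ∫ Q, ((Q : Matrix (Fin p) (Fin p) ℝ) *ᵥ θ) i * ((Q : Matrix (Fin p) (Fin p) ℝ) *ᵥ θ) i
      ∂haarOrthogonal p =
    ∫ Q, ((Q : Matrix (Fin p) (Fin p) ℝ) *ᵥ θ) j * ((Q : Matrix (Fin p) (Fin p) ℝ) *ᵥ θ) j
      ∂haarOrthogonal p := by
  have hs : (Equiv.swap i j).permMatrix ℝ ∈ Matrix.orthogonalGroup (Fin p) ℝ := by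
    rw [Matrix.mem_orthogonalGroup_iff, Matrix.transpose_permMatrix, ← Matrix.permMatrix_mul]
    simp
  have h := integral_haarOrthogonal_mul_left θ ⟨_, hs⟩ fun u => u j * u j
  simp only [Matrix.permMatrix_mulVec, Function.comp_apply, Equiv.swap_apply_right] at h
  exact h

theorem integrable_haarOrthogonal_mul {p : ℕ} (θ : Fin p → ℝ) (i j : Fin p) :
    Integrable (fun Q : Matrix.orthogonalGroup (Fin p) ℝ =>
      ((Q : Matrix (Fin p) (Fin p) ℝ) *ᵥ θ) i * ((Q : Matrix (Fin p) (Fin p) ℝ) *ᵥ θ) j)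
      (haarOrthogonal p) := by
  have h := continuous_pi_iff.mp (continuous_orthogonal_mulVec θ)
  exact ((h i).mul (h j)).integrable_of_hasCompactSupport (HasCompactSupport.of_compactSpace _)

/-- The diagonal moments agree by permutation invariance and sum to |Qθ|² = |θ|². -/
theorem integral_haarOrthogonal_mul {p : ℕ} (θ : Fin p → ℝ) (i j : Fin p) :
    ∫ Q, ((Q : Matrix (Fin p) (Fin p) ℝ) *ᵥ θ) i * ((Q : Matrix (Fin p) (Fin p) ℝ) *ᵥ θ) j
      ∂haarOrthogonal p = if i = j then (θ ⬝ᵥ θ) / p else 0 := by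
  split_ifs with hij
  · subst hij
    have h : ∑ k, ∫ Q, ((Q : Matrix (Fin p) (Fin p) ℝ) *ᵥ θ) k *
        ((Q : Matrix (Fin p) (Fin p) ℝ) *ᵥ θ) k ∂haarOrthogonal p = θ ⬝ᵥ θ := by
      rw [← integral_finsetSum _ fun k _ => integrable_haarOrthogonal_mul θ k k]
      have : ∀ Q : Matrix.orthogonalGroup (Fin p) ℝ,
          ∑ k, ((Q : Matrix (Fin p) (Fin p) ℝ) *ᵥ θ) k *
            ((Q : Matrix (Fin p) (Fin p) ℝ) *ᵥ θ) k = θ ⬝ᵥ θ :=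
        fun Q => orthogonal_mulVec_dotProduct_self Q θ
      simp [this]
    rw [Finset.sum_congr rfl fun k _ => integral_haarOrthogonal_mul_self_eq θ k i] at h
    simp only [Finset.sum_const, Finset.card_univ, Fintype.card_fin, nsmul_eq_mul] at h
    have hp : (p : ℝ) ≠ 0 := by
      have := i.pos
      positivity
    rw [← h, mul_div_cancel_left₀ _ hp]
  · exact integral_haarOrthogonal_mul_of_ne θ hij

theorem lintegral_haarOrthogonal {p : ℕ} {κ : Type*} [Fintype κ] (θ : Fin p → ℝ) {b : ℝ}
    (hb : 0 ≤ b) (A : Matrix κ (Fin p) ℝ) :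
    ∫⁻ Q, ENNReal.ofReal (b + (A *ᵥ ((Q : Matrix (Fin p) (Fin p) ℝ) *ᵥ θ)) ⬝ᵥ
      (A *ᵥ ((Q : Matrix (Fin p) (Fin p) ℝ) *ᵥ θ))) ∂haarOrthogonal p =
      ENNReal.ofReal (b + (θ ⬝ᵥ θ) / p * frobSq A) := by
  have hc : Continuous fun Q : Matrix.orthogonalGroup (Fin p) ℝ =>
      A *ᵥ ((Q : Matrix (Fin p) (Fin p) ℝ) *ᵥ θ) :=
    Continuous.matrix_mulVec continuous_const (continuous_orthogonal_mulVec θ)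
  have hc2 : Continuous fun Q : Matrix.orthogonalGroup (Fin p) ℝ =>
      (A *ᵥ ((Q : Matrix (Fin p) (Fin p) ℝ) *ᵥ θ)) ⬝ᵥ
      (A *ᵥ ((Q : Matrix (Fin p) (Fin p) ℝ) *ᵥ θ)) := hc.dotProduct hc
  have hi := hc2.integrable_of_hasCompactSupport (μ := haarOrthogonal p)
    (HasCompactSupport.of_compactSpace _)
  have hbi : Integrable (fun Q : Matrix.orthogonalGroup (Fin p) ℝ =>
      b + (A *ᵥ ((Q : Matrix (Fin p) (Fin p) ℝ) *ᵥ θ)) ⬝ᵥ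
        (A *ᵥ ((Q : Matrix (Fin p) (Fin p) ℝ) *ᵥ θ))) (haarOrthogonal p) :=
    (integrable_const b).add hi
  rw [← ofReal_integral_eq_lintegral_ofReal hbi
    (ae_of_all _ fun Q => add_nonneg hb (dotProduct_self_nonneg' _)),
    integral_add (integrable_const b) hi]
  congr 2
  · simp
  · have e : ∀ u : Fin p → ℝ, (A *ᵥ u) ⬝ᵥ (A *ᵥ u) =
        ∑ a, ∑ i, ∑ j, A a i * A a j * (u i * u j) := fun u => by
      simp only [dotProduct, Matrix.mulVec, Finset.sum_mul_sum]
      refine Finset.sum_congr rfl fun a _ => Finset.sum_congr rfl fun i _ =>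
        Finset.sum_congr rfl fun j _ => by ring
    have hI := fun a i j => (integrable_haarOrthogonal_mul θ i j).const_mul (A a i * A a j)
    simp only [e]
    rw [integral_finsetSum _ fun a _ => integrable_finsetSum _ fun i _ =>
      integrable_finsetSum _ fun j _ => hI a i j, frobSq, Finset.mul_sum]
    refine Finset.sum_congr rfl fun a _ => ?_
    rw [integral_finsetSum _ fun i _ => integrable_finsetSum _ fun j _ => hI a i j,
      dotProduct.eq_1 (A a), Finset.mul_sum]
    refine Finset.sum_congr rfl fun i _ => ?_
    rw [integral_finsetSum _ fun j _ => hI a i j]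
    simp only [integral_const_mul, integral_haarOrthogonal_mul]
    simp [mul_comm]

/-! ### Measurability of matrix valued functions -/

/-- All entries of a matrix valued function are measurable. -/
def EntrywiseMeasurable {Ω ι κ : Type*} [MeasurableSpace Ω] (F : Ω → Matrix ι κ ℝ) : Prop :=
  ∀ i j, Measurable fun ω => F ω i j

namespace EntrywiseMeasurable

variable {Ω ι κ μ : Type*} [MeasurableSpace Ω] {F : Ω → Matrix ι κ ℝ}

theorem const (A : Matrix ι κ ℝ) : EntrywiseMeasurable fun _ : Ω => A :=
  fun _ _ => measurable_const

theorem mul [Fintype κ] {G : Ω → Matrix κ μ ℝ} (hF : EntrywiseMeasurable F)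
    (hG : EntrywiseMeasurable G) : EntrywiseMeasurable fun ω => F ω * G ω := fun i j => by
  simp only [Matrix.mul_apply]
  exact Finset.measurable_sum _ fun k _ => (hF i k).mul (hG k j)

theorem sub {G : Ω → Matrix ι κ ℝ} (hF : EntrywiseMeasurable F)
    (hG : EntrywiseMeasurable G) : EntrywiseMeasurable fun ω => F ω - G ω :=
  fun i j => (hF i j).sub (hG i j)

theorem dotProduct [Fintype κ] {u v : Ω → κ → ℝ} (hu : Measurable u) (hv : Measurable v) :
    Measurable fun ω => u ω ⬝ᵥ v ω :=
  Finset.measurable_sum _ fun k _ =>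
    ((measurable_pi_apply k).comp hu).mul ((measurable_pi_apply k).comp hv)

theorem mulVec [Fintype κ] {v : Ω → κ → ℝ} (hF : EntrywiseMeasurable F) (hv : Measurable v) :
    Measurable fun ω => F ω *ᵥ v ω :=
  measurable_pi_lambda _ fun i =>
    dotProduct (u := fun ω => F ω i) (measurable_pi_lambda _ fun j => hF i j) hv

theorem frobSq [Fintype ι] [Fintype κ] (hF : EntrywiseMeasurable F) :
    Measurable fun ω => frobSq (F ω) :=
  Finset.measurable_sum _ fun i _ =>
    dotProduct (measurable_pi_lambda _ fun j => hF i j) (measurable_pi_lambda _ fun j => hF i j)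

theorem comp {μ' : Type*} {M : Matrix ι κ ℝ → Matrix μ μ' ℝ}
    (hM : EntrywiseMeasurable fun Z : ι → κ → ℝ => M (Matrix.of Z))
    (hF : EntrywiseMeasurable F) : EntrywiseMeasurable fun ω => M (F ω) := fun i j =>
  (hM i j).comp (g := fun Z : ι → κ → ℝ => M (Matrix.of Z) i j) (f := fun ω k l => F ω k l)
    (measurable_pi_lambda _ fun k => measurable_pi_lambda _ fun l => hF k l)

theorem of {f : Ω → ι → κ → ℝ} (hf : Measurable f) :
    EntrywiseMeasurable fun ω => Matrix.of (f ω) := fun i j =>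
  (measurable_pi_apply j).comp ((measurable_pi_apply i).comp hf)

end EntrywiseMeasurable

/-! ### Frobenius norms and the coordinate embedding -/

theorem frobSq_eq_trace {ι κ : Type*} [Fintype ι] [Fintype κ] (A : Matrix ι κ ℝ) :
    frobSq A = (Aᵀ * A).trace := by
  simp only [frobSq, Matrix.trace, Matrix.diag, Matrix.mul_apply, Matrix.transpose_apply,
    dotProduct]
  exact Finset.sum_comm

theorem frobSq_neg {ι κ : Type*} [Fintype ι] [Fintype κ] (A : Matrix ι κ ℝ) :
    frobSq (-A) = frobSq A := by
  simp [frobSq_eq_trace]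

theorem frobSq_mul_of_transpose_mul_eq_one {ι κ μ : Type*} [Fintype ι] [Fintype κ] [Fintype μ]
    [DecidableEq κ] {B : Matrix ι κ ℝ} (hB : Bᵀ * B = 1) (A : Matrix κ μ ℝ) :
    frobSq (B * A) = frobSq A := by
  rw [frobSq_eq_trace, frobSq_eq_trace, Matrix.transpose_mul, Matrix.mul_assoc,
    ← Matrix.mul_assoc Bᵀ, hB, Matrix.one_mul]

/-- The isometric embedding of the first `d` coordinates. -/
def firstCols (d m : ℕ) : Matrix (Fin (d + m)) (Fin d) ℝ :=
  (1 : Matrix (Fin (d + m)) (Fin (d + m)) ℝ).submatrix id (Fin.castAdd m)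

theorem firstCols_transpose_mul (d m : ℕ) : (firstCols d m)ᵀ * firstCols d m = 1 := by
  ext i j
  simp [firstCols, Matrix.mul_apply, Matrix.one_apply]

theorem firstRows_eq {d m : ℕ} (h : d ≤ d + m) (Q : Matrix.orthogonalGroup (Fin (d + m)) ℝ) :
    firstRows h Q = (firstCols d m)ᵀ * (Q : Matrix (Fin (d + m)) (Fin (d + m)) ℝ) := by
  ext i j
  simp [firstRows, firstCols, Matrix.mul_apply, Matrix.one_apply]
  rfl

theorem mul_firstCols {ι : Type*} {d m : ℕ} (X : Matrix ι (Fin (d + m)) ℝ) :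
    X * firstCols d m = X.submatrix id (Fin.castAdd m) := by
  ext i j
  simp [firstCols, Matrix.mul_apply, Matrix.one_apply]

/-- With X = [X₁ X₂] the matrix has block rows [I - MX₁, -MX₂] and [0, I]; the lower identity block
contributes m. -/
theorem frobSq_one_sub {n d m : ℕ} (M : Matrix (Fin d) (Fin n) ℝ)
    (X : Matrix (Fin n) (Fin (d + m)) ℝ) :
    frobSq (1 - firstCols d m * M * X) = m + frobSq (M * X.submatrix id (Fin.castAdd m) - 1) +
      frobSq (M * X.submatrix id (Fin.natAdd d)) := by
  have h1 : ∀ i j, (firstCols d m * M * X) (Fin.castAdd m i) j = (M * X) i j := fun i j => by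
    rw [Matrix.mul_assoc]
    simp [firstCols, Matrix.mul_apply, Matrix.one_apply]
  have h2 : ∀ i j, (firstCols d m * M * X) (Fin.natAdd d i) j = 0 := fun i j => by
    rw [Matrix.mul_assoc, Matrix.mul_apply]
    refine Finset.sum_eq_zero fun k _ => ?_
    simp [firstCols, Matrix.one_apply, Fin.ext_iff]
    intro h
    omega
  have h3 : ∀ (i : Fin d) (j : Fin m), Fin.castAdd m i ≠ Fin.natAdd d j := fun i j h => by
    have := congrArg Fin.val h
    simp at this
    omega
  simp only [frobSq, dotProduct, Fin.sum_univ_add, Matrix.sub_apply, h1, h2, Matrix.one_apply,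
    h3, (h3 _ _).symm, Fin.castAdd_inj, Fin.natAdd_inj, if_false, sub_zero, zero_sub]
  have h4 : ∀ i j, (M * X.submatrix id (Fin.castAdd m)) i j = (M * X) i (Fin.castAdd m j) :=
    fun i j => rfl
  have h5 : ∀ i j, (M * X.submatrix id (Fin.natAdd d)) i j = (M * X) i (Fin.natAdd d j) :=
    fun i j => rfl
  simp only [h4, h5, Finset.sum_add_distrib, ← sq, sub_sq_comm]
  simp
  ring

/-! ### The expected risk of a linear estimator -/

/-- The risk of a linear estimator, as a function of a sample with rotated covariates. -/
theorem risk_linear_eq {n d m : ℕ} (h : d ≤ d + m) (θ : Fin (d + m) → ℝ) (σ : ℝ)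
    (M : Matrix (Fin n) (Fin d) ℝ → Matrix (Fin d) (Fin n) ℝ)
    (hM : EntrywiseMeasurable fun Z : Fin n → Fin d → ℝ => M (Matrix.of Z))
    (Q : Matrix.orthogonalGroup (Fin (d + m)) ℝ) :
    ∫⁻ S, risk θ σ (firstRows h Q)
      (M (dataMatrix S * (firstRows h Q)ᵀ) *ᵥ responses S) ∂sampleLaw n θ σ =
    ∫⁻ X, ENNReal.ofReal (σ ^ 2 + σ ^ 2 * frobSq (M (Matrix.of X * firstCols d m)) +
      ((1 - firstCols d m * M (Matrix.of X * firstCols d m) * Matrix.of X) *ᵥ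
        ((Q : Matrix (Fin (d + m)) (Fin (d + m)) ℝ) *ᵥ θ)) ⬝ᵥ
      ((1 - firstCols d m * M (Matrix.of X * firstCols d m) * Matrix.of X) *ᵥ
        ((Q : Matrix (Fin (d + m)) (Fin (d + m)) ℝ) *ᵥ θ))) ∂gaussMat n (d + m) := by
  set P := firstRows h Q with hP
  set E := firstCols d m with hE
  have hQ' : (Q : Matrix (Fin (d + m)) (Fin (d + m)) ℝ) * (Q : Matrix _ _ ℝ)ᵀ = 1 :=
    (Matrix.mem_orthogonalGroup_iff _ ℝ).mp Q.2
  have hPE : Pᵀ = (Q : Matrix (Fin (d + m)) (Fin (d + m)) ℝ)ᵀ * E := by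
    rw [hP, firstRows_eq, Matrix.transpose_mul, Matrix.transpose_transpose]
  simp only [risk_eq]
  have hX : EntrywiseMeasurable fun S : Fin n → (Fin (d + m) → ℝ) × ℝ => dataMatrix S :=
    EntrywiseMeasurable.of 
      (f := fun (S : Fin n → (Fin (d + m) → ℝ) × ℝ) i => (S i).1) (by fun_prop)
  have hv : Measurable fun S : Fin n → (Fin (d + m) → ℝ) × ℝ =>
      θ - Pᵀ *ᵥ (M (dataMatrix S * Pᵀ) *ᵥ responses S) :=
    measurable_const.sub ((EntrywiseMeasurable.const Pᵀ).mulVec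
      ((hM.comp (hX.mul (EntrywiseMeasurable.const Pᵀ))).mulVec
        (by unfold responses; fun_prop)))
  have hF : Measurable fun S : Fin n → (Fin (d + m) → ℝ) × ℝ => ENNReal.ofReal (σ ^ 2 +
      (θ - Pᵀ *ᵥ (M (dataMatrix S * Pᵀ) *ᵥ responses S)) ⬝ᵥ
      (θ - Pᵀ *ᵥ (M (dataMatrix S * Pᵀ) *ᵥ responses S))) :=
    (measurable_const.add (EntrywiseMeasurable.dotProduct hv hv)).ennreal_ofReal
  rw [← (measurePreserving_sample n θ σ).lintegral_comp hF, lintegral_prod]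
  swap
  · exact (hF.comp (measurePreserving_sample n θ σ).measurable).aemeasurable
  have e1 : ∀ (X : Fin n → Fin (d + m) → ℝ) (ε : Fin n → ℝ),
      dataMatrix (fun k => (X k, X k ⬝ᵥ θ + ε k)) = Matrix.of X := fun X ε => rfl
  have e2 : ∀ (X : Fin n → Fin (d + m) → ℝ) (ε : Fin n → ℝ),
      responses (fun k => (X k, X k ⬝ᵥ θ + ε k)) = Matrix.of X *ᵥ θ + ε := fun X ε => rfl
  have e3 : ∀ (X : Fin n → Fin (d + m) → ℝ) (ε : Fin n → ℝ),
      θ - Pᵀ *ᵥ (M (Matrix.of X * Pᵀ) *ᵥ (Matrix.of X *ᵥ θ + ε)) =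
      (θ - Pᵀ *ᵥ (M (Matrix.of X * Pᵀ) *ᵥ (Matrix.of X *ᵥ θ))) +
        (-(Pᵀ * M (Matrix.of X * Pᵀ))) *ᵥ ε := fun X ε => by
    rw [Matrix.mulVec_add, Matrix.mulVec_add, Matrix.neg_mulVec, ← Matrix.mulVec_mulVec ε]
    abel
  have hPP : Pᵀᵀ * Pᵀ = 1 := by
    rw [hPE, Matrix.transpose_mul, Matrix.transpose_transpose, Matrix.mul_assoc,
      ← Matrix.mul_assoc _ _ E, hQ', Matrix.one_mul, hE, firstCols_transpose_mul]
  simp only [e1, e2, e3, lintegral_add_mulVec _ (sq_nonneg σ), frobSq_neg,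
    frobSq_mul_of_transpose_mul_eq_one hPP, Real.coe_toNNReal _ (sq_nonneg σ)]
  have hX : EntrywiseMeasurable fun X : Fin n → Fin (d + m) → ℝ => Matrix.of X :=
    EntrywiseMeasurable.of measurable_id
  have hMX := hM.comp (hX.mul (EntrywiseMeasurable.const Pᵀ))
  have hv : Measurable fun X : Fin n → Fin (d + m) → ℝ =>
      θ - Pᵀ *ᵥ (M (Matrix.of X * Pᵀ) *ᵥ (Matrix.of X *ᵥ θ)) :=
    measurable_const.sub ((EntrywiseMeasurable.const Pᵀ).mulVec
      (hMX.mulVec (hX.mulVec measurable_const)))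
  have hH : Measurable fun X : Fin n → Fin (d + m) → ℝ => ENNReal.ofReal (σ ^ 2 +
      ((θ - Pᵀ *ᵥ (M (Matrix.of X * Pᵀ) *ᵥ (Matrix.of X *ᵥ θ))) ⬝ᵥ
        (θ - Pᵀ *ᵥ (M (Matrix.of X * Pᵀ) *ᵥ (Matrix.of X *ᵥ θ))) +
        σ ^ 2 * frobSq (M (Matrix.of X * Pᵀ)))) :=
    (((EntrywiseMeasurable.dotProduct hv hv).add
      (hMX.frobSq.const_mul (σ ^ 2))).const_add (σ ^ 2)).ennreal_ofReal
  -- Rotating the rows by Q⁻¹ = Qᵀ replaces X by XQ without changing its law. Then XQPᵀ = XE, so the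
  -- argument of M no longer involves Q.
  rw [← (measurePreserving_gaussMat_mul Q⁻¹).lintegral_comp hH]
  refine lintegral_congr fun X => ?_
  have e4 : (Matrix.of fun k => ((Q⁻¹ : Matrix.orthogonalGroup (Fin (d + m)) ℝ) :
      Matrix (Fin (d + m)) (Fin (d + m)) ℝ) *ᵥ X k) =
      Matrix.of X * (Q : Matrix (Fin (d + m)) (Fin (d + m)) ℝ) := by
    ext k j
    simp [Matrix.mul_apply, Matrix.mulVec, dotProduct, mul_comm]
  rw [e4]
  have e5 : Matrix.of X * (Q : Matrix (Fin (d + m)) (Fin (d + m)) ℝ) * Pᵀ = Matrix.of X * E := by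
    rw [hPE, Matrix.mul_assoc, ← Matrix.mul_assoc _ _ E, hQ', Matrix.one_mul]
  rw [e5]
  congr 1
  -- Applying the isometry Q to the residual turns θ into Qθ and QPᵀ into E.
  rw [← orthogonal_mulVec_dotProduct_self Q]
  have e6 : (Q : Matrix (Fin (d + m)) (Fin (d + m)) ℝ) *ᵥ (θ - Pᵀ *ᵥ (M (Matrix.of X * E) *ᵥ
      ((Matrix.of X * (Q : Matrix (Fin (d + m)) (Fin (d + m)) ℝ)) *ᵥ θ))) =
      (1 - E * M (Matrix.of X * E) * Matrix.of X) *ᵥ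
        ((Q : Matrix (Fin (d + m)) (Fin (d + m)) ℝ) *ᵥ θ) := by
    rw [hPE, Matrix.mulVec_sub, Matrix.sub_mulVec, Matrix.one_mulVec]
    simp only [Matrix.mulVec_mulVec, ← Matrix.mul_assoc, hQ', Matrix.one_mul]
  rw [e6]
  ring

/-- The expected risk of a linear estimator in the model of size `d`. -/
theorem expectedRisk_linear {n d m : ℕ} (h : d ≤ d + m) (θ : Fin (d + m) → ℝ) (σ : ℝ)
    (M : Matrix (Fin n) (Fin d) ℝ → Matrix (Fin d) (Fin n) ℝ)
    (hM : EntrywiseMeasurable fun Z : Fin n → Fin d → ℝ => M (Matrix.of Z)) :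
    expectedRisk h n θ σ (fun Z y => M Z *ᵥ y) =
    ∫⁻ Z, ENNReal.ofReal (σ ^ 2 + m * ((θ ⬝ᵥ θ) / (d + m : ℕ)) +
      ((θ ⬝ᵥ θ) / (d + m : ℕ) * frobSq (M (Matrix.of Z) * Matrix.of Z - 1) +
      (σ ^ 2 + m * ((θ ⬝ᵥ θ) / (d + m : ℕ))) * frobSq (M (Matrix.of Z)))) ∂gaussMat n d := by
  have hτ : 0 ≤ (θ ⬝ᵥ θ) / ((d + m : ℕ) : ℝ) :=
    div_nonneg (dotProduct_self_nonneg' θ) (Nat.cast_nonneg _)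
  rw [expectedRisk]
  simp only [risk_linear_eq h θ σ M hM]
  have hX : EntrywiseMeasurable fun X : Fin n → Fin (d + m) → ℝ => Matrix.of X :=
    EntrywiseMeasurable.of measurable_id
  have hMX := hM.comp (hX.mul (EntrywiseMeasurable.const (firstCols d m)))
  have hA := (EntrywiseMeasurable.const (Ω := Fin n → Fin (d + m) → ℝ)
    (1 : Matrix (Fin (d + m)) (Fin (d + m)) ℝ)).sub
      (((EntrywiseMeasurable.const (firstCols d m)).mul hMX).mul hX)
  -- Tonelli puts the Haar average inside, where X is fixed and only Qθ varies.
  rw [lintegral_lintegral_swap]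
  swap
  · have hv := EntrywiseMeasurable.mulVec (Ω := Matrix.orthogonalGroup (Fin (d + m)) ℝ ×
        (Fin n → Fin (d + m) → ℝ)) (fun i j => (hA i j).comp measurable_snd)
      ((continuous_orthogonal_mulVec θ).measurable.comp measurable_fst)
    exact ((((hMX.frobSq.comp measurable_snd).const_mul (σ ^ 2)).const_add (σ ^ 2)).add
      (EntrywiseMeasurable.dotProduct hv hv)).ennreal_ofReal.aemeasurable
  have h0 : ∀ A : Matrix (Fin d) (Fin n) ℝ, 0 ≤ σ ^ 2 + σ ^ 2 * frobSq A := fun A =>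
    add_nonneg (sq_nonneg σ) (mul_nonneg (sq_nonneg σ) (frobSq_nonneg A))
  simp only [lintegral_haarOrthogonal θ (h0 _), mul_firstCols, frobSq_one_sub]
  set τ := (θ ⬝ᵥ θ) / ((d + m : ℕ) : ℝ)
  have hZ : EntrywiseMeasurable fun q : (Fin n → Fin d → ℝ) × (Fin n → Fin m → ℝ) =>
      Matrix.of q.1 := EntrywiseMeasurable.of measurable_fst
  have hW : EntrywiseMeasurable fun q : (Fin n → Fin d → ℝ) × (Fin n → Fin m → ℝ) =>
      Matrix.of q.2 := EntrywiseMeasurable.of measurable_snd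
  have hG : Measurable fun q : (Fin n → Fin d → ℝ) × (Fin n → Fin m → ℝ) =>
      ENNReal.ofReal (σ ^ 2 + σ ^ 2 * frobSq (M (Matrix.of q.1)) +
        τ * (m + frobSq (M (Matrix.of q.1) * Matrix.of q.1 - 1) +
          frobSq (M (Matrix.of q.1) * Matrix.of q.2))) :=
    (((hM.comp hZ).frobSq.const_mul _ |>.const_add _).add
      ((((((hM.comp hZ).mul hZ).sub (EntrywiseMeasurable.const 1)).frobSq.const_add _).add
        ((hM.comp hZ).mul hW).frobSq).const_mul _)).ennreal_ofReal
  -- The columns split into the observed Z and an independent unobserved W, on which M does not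
  -- depend.
  have h1 := (measurePreserving_split n d m).lintegral_comp hG
  refine h1.trans ?_
  rw [lintegral_prod _ hG.aemeasurable]
  refine lintegral_congr fun Z => ?_
  -- The factor τ is absorbed into M as √τ to match the form of `lintegral_frobSq_mul`.
  have e : ∀ W : Fin n → Fin m → ℝ, σ ^ 2 + σ ^ 2 * frobSq (M (Matrix.of Z)) +
        τ * (m + frobSq (M (Matrix.of Z) * Matrix.of Z - 1) +
          frobSq (M (Matrix.of Z) * Matrix.of W)) =
      (σ ^ 2 + σ ^ 2 * frobSq (M (Matrix.of Z)) +
        τ * (m + frobSq (M (Matrix.of Z) * Matrix.of Z - 1))) +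
        frobSq ((√τ • M (Matrix.of Z)) * Matrix.of W) := fun W => by
    have : ∀ {ι κ : Type} [Fintype ι] [Fintype κ] (A : Matrix ι κ ℝ),
        frobSq (√τ • A) = τ * frobSq A := fun A => by
      simp only [frobSq_eq_trace, Matrix.transpose_smul, Matrix.smul_mul, Matrix.mul_smul,
        smul_smul, Real.mul_self_sqrt hτ, Matrix.trace_smul, smul_eq_mul]
    rw [Matrix.smul_mul, this]; ring
  simp only [e]
  rw [lintegral_frobSq_mul]
  · congr 1
    rw [frobSq_eq_trace (√τ • _)]
    simp only [Matrix.transpose_smul, Matrix.smul_mul, Matrix.mul_smul,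
        smul_smul, Real.mul_self_sqrt hτ, Matrix.trace_smul, smul_eq_mul, ← frobSq_eq_trace]
    ring
  · exact add_nonneg (h0 _) (mul_nonneg hτ (add_nonneg (Nat.cast_nonneg _) (frobSq_nonneg _)))

theorem entrywiseMeasurable_ridgeMatrix {n d : ℕ} (lam : ℝ≥0) :
    EntrywiseMeasurable fun Z : Fin n → Fin d → ℝ => ridgeMatrix lam (Matrix.of Z) :=
  fun i j => measurable_ridgeMatrix lam i j

theorem ridge_eq_fun {n d : ℕ} (lam : ℝ≥0) :
    (ridge lam : Matrix (Fin n) (Fin d) ℝ → (Fin n → ℝ) → Fin d → ℝ) =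
      fun Z y => ridgeMatrix lam Z *ᵥ y :=
  funext fun Z => funext fun y => ridge_eq_ridgeMatrix_mulVec lam Z y

theorem frobSq_zero {ι κ : Type*} [Fintype ι] [Fintype κ] :
    frobSq (0 : Matrix ι κ ℝ) = 0 := by
  simp [frobSq_eq_trace]

theorem frobSq_one (d : ℕ) : frobSq (1 : Matrix (Fin d) (Fin d) ℝ) = d := by
  simp [frobSq_eq_trace]

/-! ### Optimality of ridge among linear estimators, and monotonicity -/

/-- For `θ ≠ 0` some ridge parameter is at least as good as every linear estimator. -/
theorem exists_ridge_le_linear {p : ℕ} (n d : ℕ) (hd : d ≤ p) {θ : Fin p → ℝ} (hθ : θ ≠ 0)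
    {σ : ℝ} (hσ : 0 < σ) : ∃ lam : ℝ≥0, ∀ M : Matrix (Fin n) (Fin d) ℝ → Matrix (Fin d) (Fin n) ℝ,
      (EntrywiseMeasurable fun Z : Fin n → Fin d → ℝ => M (Matrix.of Z)) →
      expectedRisk hd n θ σ (ridge lam) ≤ expectedRisk hd n θ σ fun Z y => M Z *ᵥ y := by
  obtain ⟨m, rfl⟩ := Nat.exists_eq_add_of_le hd
  have hp : 0 < d + m := by
    rcases Nat.eq_zero_or_pos (d + m) with h | h
    · exact absurd (funext fun i => absurd i.2 (by omega)) hθ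
    · exact h
  have hτ : 0 < (θ ⬝ᵥ θ) / ((d + m : ℕ) : ℝ) := by
    refine div_pos (lt_of_le_of_ne (dotProduct_self_nonneg' θ) fun h => hθ ?_) (by exact_mod_cast hp)
    exact dotProduct_self_eq_zero.mp h.symm
  have hs : 0 < σ ^ 2 + m * ((θ ⬝ᵥ θ) / ((d + m : ℕ) : ℝ)) := by positivity
  -- The optimal λ is the ratio of the two weights in `expectedRisk_linear`, effective noise over
  -- signal per coordinate; it does not depend on Z, so the comparison can be made pointwise.
  have hl : 0 < (σ ^ 2 + m * ((θ ⬝ᵥ θ) / ((d + m : ℕ) : ℝ))) / ((θ ⬝ᵥ θ) / ((d + m : ℕ) : ℝ)) :=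
    div_pos hs hτ
  obtain ⟨lam, hlam⟩ := NNReal.canLift.prf _ hl.le
  rw [← hlam, NNReal.coe_pos] at hl
  replace hlam := (eq_div_iff hτ.ne').mp hlam
  refine ⟨lam, fun M hM => ?_⟩
  rw [ridge_eq_fun, expectedRisk_linear hd θ σ _ (entrywiseMeasurable_ridgeMatrix _),
    expectedRisk_linear hd θ σ M hM]
  refine lintegral_mono fun Z => ENNReal.ofReal_le_ofReal (add_le_add_right ?_ _)
  rw [← hlam]
  have h := mul_le_mul_of_nonneg_left (frobSq_ridgeMatrix_le hl (Matrix.of Z) (M (Matrix.of Z)))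
    hτ.le
  linarith

theorem expectedRisk_zero_ne_top {p : ℕ} (n d : ℕ) (hd : d ≤ p) (θ : Fin p → ℝ) (σ : ℝ) :
    expectedRisk hd n θ σ (fun _ _ => 0) ≠ ⊤ := by
  have : IsProbabilityMeasure (sampleLaw n θ σ) := by
    rw [← (measurePreserving_sample n θ σ).map_eq]
    exact Measure.isProbabilityMeasure_map (measurePreserving_sample n θ σ).measurable.aemeasurable
  simp [expectedRisk, risk_eq]

theorem firstRows_succ {p d : ℕ} (hd : d + 1 ≤ p) (Q : Matrix.orthogonalGroup (Fin p) ℝ) :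
    firstRows (Nat.le_of_succ_le hd) Q = (firstCols d 1)ᵀ * firstRows hd Q := by
  ext i j
  simp [firstRows, firstCols, Matrix.mul_apply, Matrix.one_apply]
  rfl

/-- An estimator in the model of size `d` has the same expected risk as the estimator in the model
of size `d + 1` that ignores the last feature. -/
theorem expectedRisk_succ_pad {p d : ℕ} (hd : d + 1 ≤ p) (n : ℕ) (θ : Fin p → ℝ) (σ : ℝ)
    (M : Matrix (Fin n) (Fin d) ℝ → Matrix (Fin d) (Fin n) ℝ) :
    expectedRisk hd n θ σ (fun Z y => (firstCols d 1 * M (Z * firstCols d 1)) *ᵥ y) =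
      expectedRisk (Nat.le_of_succ_le hd) n θ σ fun Z y => M Z *ᵥ y := by
  simp only [expectedRisk, risk_eq, firstRows_succ hd, Matrix.transpose_mul,
    Matrix.transpose_transpose, Matrix.mulVec_mulVec, Matrix.mul_assoc]

/-- Without signal the optimal risk is the noise level. -/
theorem optimalRisk_zero {p d : ℕ} (hd : d ≤ p) (n : ℕ) (σ : ℝ) :
    optimalRisk hd n (0 : Fin p → ℝ) σ = ENNReal.ofReal (σ ^ 2) := by
  obtain ⟨m, rfl⟩ := Nat.exists_eq_add_of_le hd
  have h : ∀ lam : ℝ≥0, expectedRisk hd n (0 : Fin (d + m) → ℝ) σ (ridge lam) =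
      ∫⁻ Z, ENNReal.ofReal (σ ^ 2 + σ ^ 2 * frobSq (ridgeMatrix lam (Matrix.of Z)))
        ∂gaussMat n d := fun lam => by
    rw [ridge_eq_fun, expectedRisk_linear hd 0 σ _ (entrywiseMeasurable_ridgeMatrix _)]
    simp
  have hle : ∀ k : ℕ, optimalRisk hd n (0 : Fin (d + m) → ℝ) σ ≤
      ENNReal.ofReal (σ ^ 2 + σ ^ 2 * (d * (1 / ((k : ℝ) + 1)))) := fun k => by
    refine (iInf_le _ ((k : ℝ≥0) + 1)).trans ?_
    rw [h]
    calc _ ≤ ∫⁻ _, ENNReal.ofReal (σ ^ 2 + σ ^ 2 * (d * (1 / ((k : ℝ) + 1)))) ∂gaussMat n d := by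
          refine lintegral_mono fun Z => ENNReal.ofReal_le_ofReal (add_le_add_right
            (mul_le_mul_of_nonneg_left ?_ (sq_nonneg σ)) _)
          -- Comparison with M = 0 gives λ‖M‖² ≤ ‖I‖² = d with λ = k + 1, a bound uniform in Z.
          have h1 := frobSq_ridgeMatrix_le (lam := (k : ℝ≥0) + 1) (by positivity) (Matrix.of Z) 0
          rw [Matrix.zero_mul, zero_sub, frobSq_neg, frobSq_one, frobSq_zero, mul_zero,
            add_zero] at h1
          push_cast at h1
          have h2 := frobSq_nonneg (ridgeMatrix ((k : ℝ≥0) + 1) (Matrix.of Z) * Matrix.of Z - 1)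
          rw [mul_one_div, le_div_iff₀ (by positivity)]
          linarith
      _ = _ := by simp
  refine le_antisymm ?_ (le_iInf fun lam => ?_)
  · refine ge_of_tendsto' (f := fun k : ℕ => ENNReal.ofReal
      (σ ^ 2 + σ ^ 2 * (d * (1 / ((k : ℝ) + 1))))) (x := Filter.atTop) ?_ hle
    refine ENNReal.tendsto_ofReal ?_
    simpa using ((tendsto_one_div_add_atTop_nhds_zero_nat (𝕜 := ℝ)).const_mul
      (d : ℝ)).const_mul (σ ^ 2) |>.const_add (σ ^ 2)
  · rw [h]
    calc ENNReal.ofReal (σ ^ 2) = ∫⁻ _, ENNReal.ofReal (σ ^ 2) ∂gaussMat n d := by simp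
      _ ≤ _ := lintegral_mono fun Z => ENNReal.ofReal_le_ofReal
          (le_add_of_nonneg_right (mul_nonneg (sq_nonneg σ) (frobSq_nonneg _)))

end ProjRidge

open ProjRidge

theorem theorem3 (p n : ℕ) (θ : Fin p → ℝ) (σ : ℝ) (hσ : 0 < σ) :
    (∀ (d : ℕ) (hd : d ≤ p),
      ProjRidge.optimalRisk hd n θ σ ≠ ⊤ ∧
      (θ ≠ 0 → ∃ lam : ℝ≥0,
        ProjRidge.expectedRisk hd n θ σ (ProjRidge.ridge lam) =
          ProjRidge.optimalRisk hd n θ σ)) ∧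
    ∀ (d : ℕ) (hd : d + 1 ≤ p),
      ProjRidge.optimalRisk hd n θ σ ≤
        ProjRidge.optimalRisk (Nat.le_of_succ_le hd) n θ σ := by
  refine ⟨fun d hd => ⟨?_, fun hθ => ?_⟩, fun d hd => ?_⟩
  · by_cases hθ : θ = 0
    · subst hθ
      rw [optimalRisk_zero hd]
      exact ENNReal.ofReal_ne_top
    · obtain ⟨lam, h⟩ := exists_ridge_le_linear n d hd hθ hσ
      refine ne_top_of_le_ne_top (expectedRisk_zero_ne_top n d hd θ σ) ((iInf_le _ lam).trans ?_)
      -- The competitor here is the zero estimator, whose risk is finite.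
      simpa using h (fun _ => 0) (EntrywiseMeasurable.const 0)
  · obtain ⟨lam, h⟩ := exists_ridge_le_linear n d hd hθ hσ
    refine ⟨lam, le_antisymm (le_iInf fun l => ?_) (iInf_le _ lam)⟩
    rw [ridge_eq_fun l]
    exact h _ (entrywiseMeasurable_ridgeMatrix l)
  · by_cases hθ : θ = 0
    · subst hθ
      rw [optimalRisk_zero, optimalRisk_zero]
    · obtain ⟨lam, h⟩ := exists_ridge_le_linear n (d + 1) hd hθ hσ
      refine (iInf_le _ lam).trans (le_iInf fun l => ?_)
      -- Each ridge estimator of size d, padded by zero, competes among the linear estimators of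
      -- size d + 1.
      rw [ridge_eq_fun l, ← expectedRisk_succ_pad hd]
      have hM := (entrywiseMeasurable_ridgeMatrix (n := n) (d := d) l).comp
        ((EntrywiseMeasurable.of (Ω := Fin n → Fin (d + 1) → ℝ) measurable_id).mul
          (EntrywiseMeasurable.const (firstCols d 1)))
      exact h _ ((EntrywiseMeasurable.const (firstCols d 1)).mul hM)
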